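/- Let $K$ be a field of characteristic $0$ and let $m\ge 0$. Let $a_1,\dots,a_{2m}\in K$ be arbitrary and let $z_1,\dots,z_{2m}\in K$ be pairwise distinct (for instance, the $a_i$ and $z_i$ may be independent variables and $K$ any field containing them together with the elements $\sqrt{z_i}$, $\zeta_i$ below). For a skew-symmetric $2m\times 2m$ matrix $(b_{ij})$ write \[ \operatorname{pfaff}_{1\le i,j\le 2m}(b_{ij})=\frac1{2^m m!}\sum_{\sigma\in S_{2m}}\operatorname{sgn}(\sigma)\prod_{i=1}^m b_{\sigma(2i-1),\sigma(2i)} ; \] diagonal entries of the form $0/x$ below are read as $0$ (they do not enter the Pfaffian). Let $S\subseteq[2m]=\{1,\dots,2m\}$ be any subset of cardinality $m$ and put \[ D_S=(-1)^{\frac12 m(m+1)+\sum_{s\in S}s}\prod_{i\in S,\,j\notin S}(z_j-z_i)\;\det_{i\in S,\,j\notin S}\left(\frac{a_j-a_i}{z_j-z_i}\right), \] where the rows (indexed by $S$) and the columns (indexed by $[2m]\setminus S$) of the determinant are taken in increasing order. Then: (1) for every choice of square roots $\sqrt{z_i}\in K$ of the $z_i$ (if they exist in $K$), \[ D_S=\prod_{1\le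 i<j\le 2m}\left(\sqrt{z_i}+\sqrt{z_j}\right)\;\operatorname{pfaff}_{1\le i,j\le 2m}\left(\frac{a_j-a_i}{\sqrt{z_j}+\sqrt{z_i}}\right); \] (2) for every choice of nonzero $\zeta_i\in K$ with $\zeta_i+\zeta_i^{-1}=z_i+2$ (if they exist in $K$), \[ D_S=\prod_{i=1}^{2m}\zeta_i^{1-m}\prod_{1\le i<j\le 2m}(1-\zeta_i\zeta_j)\;\operatorname{pfaff}_{1\le i,j\le 2m}\left(\frac{a_j-a_i}{1-\zeta_i\zeta_j}\right). \] In particular the two Pfaffian expressions agree whenever both are defined, and they do not depend on $S$ or on the choices of $\sqrt{z_i}$ and $\zeta_i$. -/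

import Mathlib

/-- The Pfaffian of a `2m × 2m` matrix (meant for skew-symmetric ones), as the normalized
signed sum over permutations,
`1 / (2 ^ m * m!) * ∑ σ, sgn σ * ∏ i, A (σ (2 i - 1)) (σ (2 i))`.
The indices `2 i - 1`, `2 i` with `1 ≤ i ≤ m` are `2 i`, `2 i + 1` with `0 ≤ i < m` in `Fin (2 * m)`. -/
noncomputable def pfaffian {K : Type*} [Field K] {m : ℕ}
    (A : Matrix (Fin (2 * m)) (Fin (2 * m)) K) : K :=
  1 / (2 ^ m * (m.factorial : K)) *
    ∑ σ : Equiv.Perm (Fin (2 * m)), ((Equiv.Perm.sign σ : ℤ) : K) *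
      ∏ i : Fin m, A (σ ⟨2 * i.val, by omega⟩) (σ ⟨2 * i.val + 1, by omega⟩)

theorem card_compl_half {m : ℕ} {S : Finset (Fin (2 * m))} (hS : S.card = m) :
    Sᶜ.card = m := by
  rw [Finset.card_compl, Fintype.card_fin, hS]
  omega

/-- The `m × m` submatrix of `A` with rows indexed by `S` and columns indexed by the complement
of `S`, both listed in increasing order. -/
def splitSubmatrix {K : Type*} {m : ℕ} (A : Matrix (Fin (2 * m)) (Fin (2 * m)) K)
    (S : Finset (Fin (2 * m))) (hS : S.card = m) : Matrix (Fin m) (Fin m) K :=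
  A.submatrix (S.orderEmbOfFin hS) (Sᶜ.orderEmbOfFin (card_compl_half hS))

/-- The signed product
`(-1) ^ (m (m + 1) / 2 + ∑ s ∈ S, s) * ∏ (z j - z i) * det ((a j - a i) / (z j - z i))`, with
`i ∈ S` and `j ∉ S`.  Elements of `S` are counted from `1`, whence `s.val + 1`. -/
def signedDet {K : Type*} [Field K] {m : ℕ} (a z : Fin (2 * m) → K)
    (S : Finset (Fin (2 * m))) (hS : S.card = m) : K :=
  (-1) ^ (m * (m + 1) / 2 + ∑ s ∈ S, (s.val + 1)) *
    (∏ i ∈ S, ∏ j ∈ Sᶜ, (z j - z i)) *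
    (splitSubmatrix (Matrix.of fun i j => (a j - a i) / (z j - z i)) S hS).det

open Finset Matrix

/-! All the expressions evaluate one determinant W, that of the matrix with rows (z_k^i | a_k
z_k^i), 0 ≤ i < m (`doubleVandermonde`). For D_S, split the rows into halves x (from S) and y.
Lagrange interpolation gives V_y = L V_x, so block elimination leaves a Schur complement whose left
factor has entries (a_j - a_i) L_ji. Up to row and column factors L is a Cauchy matrix, which
produces the determinant in D_S (`det_doubleVandermonde`); listing S first accounts for the sign
(`sign_splitEquiv`). For a Pfaffian with symmetric denominators g, antisymmetry replaces each a_y -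
a_x by 2 a_y. Averaging over permutations of one half turns the products of 1/g into determinants.
Cauchy's formula makes these, times the product of g over all pairs, a product of two Vandermondes
in z, and the resulting sum is the Laplace expansion of W
(`sum_sign_prod_div_eq_det_doubleVandermonde`). -/

/-! ### Lagrange interpolation and the Cauchy determinant. -/

theorem prod_Ioi_neg_one (K : Type*) [CommRing K] (m : ℕ) :
    ∏ i : Fin m, ∏ _j ∈ Ioi i, (-1 : K) = (-1) ^ (∑ i : Fin m, (i : ℕ)) := by
  rw [prod_comm' (t' := univ) (s' := fun j => Iio j) (by simp)]
  simp [prod_pow_eq_pow_sum]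

theorem prod_prod_compl_singleton_sub {K : Type*} [CommRing K] {m : ℕ} (x : Fin m → K) :
    ∏ i, ∏ k ∈ ({i} : Finset (Fin m))ᶜ, (x i - x k) =
      (-1) ^ (∑ i : Fin m, (i : ℕ)) * (vandermonde x).det ^ 2 := by
  rw [← prod_prod_Ioi_mul_eq_prod_prod_off_diag fun k i => x i - x k, ← prod_Ioi_neg_one, det_vandermonde,
    ← prod_pow, ← prod_mul_distrib]
  refine prod_congr rfl fun i _ => ?_
  rw [← prod_pow, ← prod_mul_distrib]
  exact prod_congr rfl fun j _ => by ring

/-- Each monomial of degree below m is its own interpolant at the nodes x; evaluate it at y_j. -/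
theorem vandermonde_eq_lagrange_mul {K : Type*} [Field K] {m : ℕ} {x : Fin m → K}
    (hx : Function.Injective x) (y : Fin m → K) :
    vandermonde y = (of fun j i => ∏ k ∈ ({i} : Finset (Fin m))ᶜ, (x i - x k)⁻¹ * (y j - x k)) *
      vandermonde x := by
  ext j k
  have h := Lagrange.eq_interpolate (f := (Polynomial.X : Polynomial K) ^ (k : ℕ)) (s := univ)
    hx.injOn (by rw [Polynomial.degree_X_pow]; simp)
  have h' := congrArg (Polynomial.eval (y j)) h
  simp only [Polynomial.eval_pow, Polynomial.eval_X, Lagrange.interpolate_apply, Lagrange.basis,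
    Lagrange.basisDivisor, Polynomial.eval_finsetSum, Polynomial.eval_mul, Polynomial.eval_C,
    Polynomial.eval_prod, Polynomial.eval_sub] at h'
  rw [vandermonde_apply, h', mul_apply]
  refine sum_congr rfl fun i _ => ?_
  rw [of_apply, vandermonde_apply, compl_singleton, mul_comm]

theorem lagrange_entry {K : Type*} [Field K] {m : ℕ} (x : Fin m → K) {t : K} {i : Fin m}
    (h : t ≠ x i) :
    ∏ k ∈ ({i} : Finset (Fin m))ᶜ, (x i - x k)⁻¹ * (t - x k) =
      (∏ k, (t - x k)) * ((∏ k ∈ ({i} : Finset (Fin m))ᶜ, (x i - x k))⁻¹ * (t - x i)⁻¹) := by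
  rw [← mul_prod_erase univ (fun k => t - x k) (mem_univ i), prod_mul_distrib, prod_inv_distrib,
    ← compl_singleton]
  field_simp [sub_ne_zero.2 h]

/-- The determinant of the Lagrange matrix with its entries scaled by `c`. -/
theorem det_lagrange_scaled {K : Type*} [Field K] {m : ℕ} {x y : Fin m → K}
    (h : ∀ i j, y j ≠ x i) (c : Fin m → Fin m → K) :
    (of fun j i => c i j * ∏ k ∈ ({i} : Finset (Fin m))ᶜ, (x i - x k)⁻¹ * (y j - x k)).det =
      (∏ i, ∏ j, (y j - x i)) * (∏ i, ∏ k ∈ ({i} : Finset (Fin m))ᶜ, (x i - x k))⁻¹ *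
        (of fun i j => c i j / (y j - x i)).det := by
  have : (of fun j i => c i j * ∏ k ∈ ({i} : Finset (Fin m))ᶜ, (x i - x k)⁻¹ * (y j - x k)) =
      of fun j i => (∏ k, (y j - x k)) * (of fun j i =>
        (∏ k ∈ ({i} : Finset (Fin m))ᶜ, (x i - x k))⁻¹ *
          (of fun i j => c i j / (y j - x i))ᵀ j i) j i := by
    ext j i
    simp only [of_apply, transpose_apply]
    rw [lagrange_entry x (h i j)]
    ring
  rw [this, det_mul_column, det_mul_row, det_transpose, prod_inv_distrib, prod_comm, mul_assoc]

theorem det_vandermonde_ne_zero_of_injective {K : Type*} [Field K] {m : ℕ} {x : Fin m → K}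
    (hx : Function.Injective x) : (vandermonde x).det ≠ 0 := det_vandermonde_ne_zero_iff.2 hx

/-- The Cauchy determinant, relative to the Vandermonde determinants. -/
theorem det_cauchy_sub {K : Type*} [Field K] {m : ℕ} {x y : Fin m → K}
    (hx : Function.Injective x) (h : ∀ i j, y j ≠ x i) :
    (∏ i, ∏ j, (y j - x i)) * (of fun i j => (y j - x i)⁻¹).det =
      (-1) ^ (∑ i : Fin m, (i : ℕ)) * (vandermonde x).det * (vandermonde y).det := by
  have hΔ := det_vandermonde_ne_zero_of_injective hx
  have h1 := det_lagrange_scaled h fun _ _ => 1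
  simp only [one_mul, one_div] at h1
  have h2 := congrArg det (vandermonde_eq_lagrange_mul hx y)
  rw [det_mul, h1, prod_prod_compl_singleton_sub] at h2
  rw [h2]
  have h3 : ((-1 : K) ^ (∑ i : Fin m, (i : ℕ))) ≠ 0 := by simp
  field_simp

/-! ### The double Vandermonde determinant by block elimination. -/

/-- The matrix with rows `(1, z, …, z ^ (m - 1), a, a z, …, a z ^ (m - 1))`. -/
def doubleVandermonde {K ι : Type*} [CommRing K] (m : ℕ) (a z : ι → K) :
    Matrix ι (Fin m ⊕ Fin m) K :=
  of fun k => Sum.elim (fun i => z k ^ (i : ℕ)) (fun i => a k * z k ^ (i : ℕ))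

theorem det_doubleVandermonde {K : Type*} [Field K] {m : ℕ} {a z : Fin m ⊕ Fin m → K}
    (hz : Function.Injective z) :
    (doubleVandermonde m a z).det = (-1) ^ (∑ i : Fin m, (i : ℕ)) *
      (∏ i, ∏ j, (z (.inr j) - z (.inl i))) *
      (of fun i j : Fin m => (a (.inr j) - a (.inl i)) / (z (.inr j) - z (.inl i))).det := by
  have hx : Function.Injective fun i => z (Sum.inl i) := fun i j h => by simpa using hz h
  have hΔ := det_vandermonde_ne_zero_of_injective hx
  have h3 : ((-1 : K) ^ (∑ i : Fin m, (i : ℕ))) ≠ 0 := by simp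
  have hs : ((-1 : K) ^ (∑ i : Fin m, (i : ℕ))) * (-1) ^ (∑ i : Fin m, (i : ℕ)) = 1 := by
    rw [← mul_pow]; simp
  have hne : ∀ i j, z (Sum.inr j) ≠ z (Sum.inl i) := fun i j h => by simpa using hz h
  have hV := vandermonde_eq_lagrange_mul hx fun j => z (Sum.inr j)
  have hd := det_lagrange_scaled hne fun i j => a (.inr j) - a (.inl i)
  rw [prod_prod_compl_singleton_sub] at hd
  set L : Matrix (Fin m) (Fin m) K := of fun j i => ∏ k ∈ ({i} : Finset (Fin m))ᶜ,
    (z (Sum.inl i) - z (Sum.inl k))⁻¹ * (z (Sum.inr j) - z (Sum.inl k)) with hL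
  set Vx := vandermonde fun i => z (Sum.inl i) with hVx
  set Vy := vandermonde fun i => z (Sum.inr i) with hVy
  have hM : doubleVandermonde m a z = fromBlocks Vx (diagonal (fun i => a (.inl i)) * Vx)
      Vy (diagonal (fun i => a (.inr i)) * Vy) := by
    ext (i | i) (j | j) <;> simp [doubleVandermonde, hVx, hVy, vandermonde_apply]
  -- Subtracting L times the upper rows clears the lower left block, because V_y = L V_x.
  have hU : fromBlocks (1 : Matrix (Fin m) (Fin m) K) 0 (-L) (1 : Matrix (Fin m) (Fin m) K) *
      doubleVandermonde m a z = fromBlocks Vx (diagonal (fun i => a (.inl i)) * Vx) 0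
        ((diagonal (fun i => a (.inr i)) * L - L * diagonal (fun i => a (.inl i))) * Vx) := by
    rw [hM, fromBlocks_multiply, hV]
    simp only [Matrix.one_mul, Matrix.zero_mul, add_zero, Matrix.neg_mul, neg_add_cancel,
      Matrix.sub_mul, Matrix.mul_assoc, neg_add_eq_sub]
  have hC : diagonal (fun i => a (.inr i)) * L - L * diagonal (fun i => a (.inl i)) =
      of fun j i => (a (.inr j) - a (.inl i)) * ∏ k ∈ ({i} : Finset (Fin m))ᶜ,
        (z (Sum.inl i) - z (Sum.inl k))⁻¹ * (z (Sum.inr j) - z (Sum.inl k)) := by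
    ext j i
    simp only [Matrix.sub_apply, diagonal_mul, mul_diagonal, hL, of_apply]
    ring
  have := congrArg det hU
  rw [det_mul, det_fromBlocks_zero₁₂, det_one, one_mul, one_mul,
    det_fromBlocks_zero₂₁, det_mul, hC, hd] at this
  rw [this]
  field_simp
  linear_combination (-(∏ i, ∏ j, (z (.inr j) - z (.inl i))) *
    (of fun i j : Fin m => (a (.inr j) - a (.inl i)) / (z (.inr j) - z (.inl i))).det) * hs

/-! ### Alternating sums and Laplace expansion. -/

/-- For alternating sums over permutations of `α ⊕ α`, each factor `N x y - N y x` may be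
replaced by `2 * N x y`. -/
theorem sum_sign_prod_antisymm {K α : Type*} [CommRing K] [Fintype α] [DecidableEq α]
    (N : α ⊕ α → α ⊕ α → K) :
    ∑ σ : Equiv.Perm (α ⊕ α), ((Equiv.Perm.sign σ : ℤ) : K) *
        ∏ i, (N (σ (.inl i)) (σ (.inr i)) - N (σ (.inr i)) (σ (.inl i))) =
      2 ^ Fintype.card α * ∑ σ : Equiv.Perm (α ⊕ α), ((Equiv.Perm.sign σ : ℤ) : K) *
        ∏ i, N (σ (.inl i)) (σ (.inr i)) := by
  -- The pairs are treated one at a time; `s` holds those still written as differences.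
  suffices h : ∀ s : Finset α, ∑ σ : Equiv.Perm (α ⊕ α), ((Equiv.Perm.sign σ : ℤ) : K) *
      ∏ i, (if i ∈ s then N (σ (.inl i)) (σ (.inr i)) - N (σ (.inr i)) (σ (.inl i))
        else N (σ (.inl i)) (σ (.inr i))) =
      2 ^ s.card * ∑ σ : Equiv.Perm (α ⊕ α), ((Equiv.Perm.sign σ : ℤ) : K) *
        ∏ i, N (σ (.inl i)) (σ (.inr i)) by
    simpa using h univ
  intro s
  induction s using Finset.induction_on with
  | empty => simp
  | insert b s hb ih =>
    rw [card_insert_of_notMem hb, pow_succ', mul_assoc, ← ih]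
    set R : Equiv.Perm (α ⊕ α) → K := fun σ => ∏ i ∈ univ.erase b,
      (if i ∈ s then N (σ (.inl i)) (σ (.inr i)) - N (σ (.inr i)) (σ (.inl i))
        else N (σ (.inl i)) (σ (.inr i)))
    have h1 : ∀ σ : Equiv.Perm (α ⊕ α),
        (∏ i, (if i ∈ s then N (σ (.inl i)) (σ (.inr i)) - N (σ (.inr i)) (σ (.inl i))
          else N (σ (.inl i)) (σ (.inr i)))) = N (σ (.inl b)) (σ (.inr b)) * R σ := fun σ => by
      rw [← mul_prod_erase univ _ (mem_univ b), if_neg hb]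
    have h2 : ∀ σ : Equiv.Perm (α ⊕ α),
        (∏ i, (if i ∈ insert b s then N (σ (.inl i)) (σ (.inr i)) - N (σ (.inr i)) (σ (.inl i))
          else N (σ (.inl i)) (σ (.inr i)))) =
        (N (σ (.inl b)) (σ (.inr b)) - N (σ (.inr b)) (σ (.inl b))) * R σ := fun σ => by
      rw [← mul_prod_erase univ _ (mem_univ b), if_pos (mem_insert_self b s)]
      congr 1
      refine prod_congr rfl fun i hi => ?_
      simp [ne_of_mem_erase hi]
    simp only [h1, h2, sub_mul, mul_sub, sum_sub_distrib]
    -- Swapping the two points of pair `b` flips the sign of σ and leaves the other factors `R`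
    -- alone.
    have h3 : ∑ σ : Equiv.Perm (α ⊕ α), ((Equiv.Perm.sign σ : ℤ) : K) *
        (N (σ (.inr b)) (σ (.inl b)) * R σ) = - ∑ σ : Equiv.Perm (α ⊕ α),
          ((Equiv.Perm.sign σ : ℤ) : K) * (N (σ (.inl b)) (σ (.inr b)) * R σ) := by
      rw [← Equiv.sum_comp (Equiv.mulRight (Equiv.swap (Sum.inl b) (Sum.inr b))), ← sum_neg_distrib]
      refine sum_congr rfl fun σ _ => ?_
      have : R (σ * Equiv.swap (Sum.inl b) (Sum.inr b)) = R σ := by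
        refine prod_congr rfl fun i hi => ?_
        have hi := ne_of_mem_erase hi
        simp only [Equiv.Perm.mul_apply]
        rw [Equiv.swap_apply_of_ne_of_ne (a := Sum.inl b) (b := Sum.inr b) (x := Sum.inl i)
            (by simpa using hi) (by simp),
          Equiv.swap_apply_of_ne_of_ne (a := Sum.inl b) (b := Sum.inr b) (x := Sum.inr i)
            (by simp) (by simpa using hi)]
      simp [this]
    rw [h3]
    ring

/-- Averaging an alternating sum over a sign-preserving embedding of another permutation group. -/
theorem sum_sign_average {K α ι : Type*} [CommRing K] [Fintype α] [DecidableEq α] [Fintype ι]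
    [DecidableEq ι] (φ : Equiv.Perm α → Equiv.Perm ι)
    (hφ : ∀ τ, Equiv.Perm.sign (φ τ) = Equiv.Perm.sign τ) (F : Equiv.Perm ι → K) :
    ((Fintype.card α).factorial : K) * ∑ σ : Equiv.Perm ι, ((Equiv.Perm.sign σ : ℤ) : K) * F σ =
      ∑ σ : Equiv.Perm ι, ((Equiv.Perm.sign σ : ℤ) : K) * ∑ τ : Equiv.Perm α,
        ((Equiv.Perm.sign τ : ℤ) : K) * F (σ * φ τ) := by
  have key : ∀ τ : Equiv.Perm α, ∑ σ : Equiv.Perm ι, ((Equiv.Perm.sign σ : ℤ) : K) *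
      (((Equiv.Perm.sign τ : ℤ) : K) * F (σ * φ τ)) =
        ∑ σ : Equiv.Perm ι, ((Equiv.Perm.sign σ : ℤ) : K) * F σ := fun τ => by
    rw [← Equiv.sum_comp (Equiv.mulRight (φ τ)) fun σ => ((Equiv.Perm.sign σ : ℤ) : K) * F σ]
    refine sum_congr rfl fun σ _ => ?_
    simp [hφ, mul_assoc]
  have h : ∀ σ : Equiv.Perm ι, ((Equiv.Perm.sign σ : ℤ) : K) * ∑ τ : Equiv.Perm α,
      ((Equiv.Perm.sign τ : ℤ) : K) * F (σ * φ τ) = ∑ τ : Equiv.Perm α,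
        ((Equiv.Perm.sign σ : ℤ) : K) * (((Equiv.Perm.sign τ : ℤ) : K) * F (σ * φ τ)) :=
    fun σ => mul_sum _ _ _
  rw [sum_congr rfl fun σ _ => h σ, sum_comm, sum_congr rfl fun τ _ => key τ]
  simp [Fintype.card_perm]

theorem sum_sign_prod_eq_sum_sign_det {K α : Type*} [CommRing K] [Fintype α] [DecidableEq α]
    (N : α ⊕ α → α ⊕ α → K) :
    ((Fintype.card α).factorial : K) * ∑ σ : Equiv.Perm (α ⊕ α),
        ((Equiv.Perm.sign σ : ℤ) : K) * ∏ i, N (σ (.inl i)) (σ (.inr i)) =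
      ∑ σ : Equiv.Perm (α ⊕ α), ((Equiv.Perm.sign σ : ℤ) : K) *
        (of fun i j => N (σ (.inl i)) (σ (.inr j))).det := by
  rw [sum_sign_average (fun τ : Equiv.Perm α => Equiv.Perm.sumCongr 1 τ) (by simp)]
  refine sum_congr rfl fun σ _ => ?_
  rw [← det_transpose, det_apply']
  simp

/-- Laplace expansion along the two column halves, indexed by all permutations instead of subsets:
each half is averaged over its own permutations, at the cost of one m! each. -/
theorem factorial_mul_det_doubleVandermonde {K : Type*} [CommRing K] {m : ℕ}
    (a z : Fin m ⊕ Fin m → K) :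
    (m.factorial : K) * (m.factorial * (doubleVandermonde m a z).det) =
      ∑ σ : Equiv.Perm (Fin m ⊕ Fin m), ((Equiv.Perm.sign σ : ℤ) : K) *
        ((∏ i, a (σ (.inr i))) * (vandermonde fun i => z (σ (.inl i))).det *
          (vandermonde fun i => z (σ (.inr i))).det) := by
  have h1 := sum_sign_average (K := K) (fun τ : Equiv.Perm (Fin m) => Equiv.Perm.sumCongr 1 τ)
    (by simp) fun σ => ∏ k, doubleVandermonde m a z (σ k) k
  have h2 := sum_sign_average (K := K) (fun τ : Equiv.Perm (Fin m) => Equiv.Perm.sumCongr τ 1)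
    (by simp) fun σ => (∏ i : Fin m, z (σ (.inl i)) ^ (i : ℕ)) *
      ((∏ i, a (σ (.inr i))) * (vandermonde fun i => z (σ (.inr i))).det)
  rw [Fintype.card_fin] at h1 h2
  rw [det_apply', h1]
  refine Eq.trans ?_ (h2.trans ?_)
  · congr 1
    refine sum_congr rfl fun σ _ => ?_
    congr 1
    rw [det_apply', mul_sum, mul_sum]
    refine sum_congr rfl fun τ _ => ?_
    have : ∏ i, a (σ (.inr (τ i))) = ∏ i, a (σ (.inr i)) :=
      Equiv.prod_comp τ fun i => a (σ (.inr i))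
    simp [doubleVandermonde, Fintype.prod_sum_type, prod_mul_distrib, vandermonde_apply, this]
    ring
  · refine sum_congr rfl fun σ _ => ?_
    congr 1
    rw [det_apply' (vandermonde fun i => z (σ (.inl i))), mul_sum, sum_mul]
    refine sum_congr rfl fun τ _ => ?_
    simp [vandermonde_apply]
    ring

/-- If `1 / g` has a Cauchy-type determinant then the alternating sum defining the Pfaffian of
`(a y - a x) / g x y` is a determinant. -/
theorem sum_sign_prod_div_eq_det_doubleVandermonde {K : Type*} [Field K] [CharZero K] {m : ℕ}
    (a z : Fin m ⊕ Fin m → K) (g : Fin m ⊕ Fin m → Fin m ⊕ Fin m → K)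
    (hg : ∀ x y, g x y = g y x) (P c : K)
    (h : ∀ σ : Equiv.Perm (Fin m ⊕ Fin m),
      P * (of fun i j : Fin m => (g (σ (.inl i)) (σ (.inr j)))⁻¹).det =
        c * ((vandermonde fun i => z (σ (.inl i))).det *
          (vandermonde fun i => z (σ (.inr i))).det)) :
    P * (1 / (2 ^ m * (m.factorial : K)) * ∑ σ : Equiv.Perm (Fin m ⊕ Fin m),
        ((Equiv.Perm.sign σ : ℤ) : K) *
        ∏ i, (a (σ (.inr i)) - a (σ (.inl i))) / g (σ (.inl i)) (σ (.inr i))) =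
      c * (doubleVandermonde m a z).det := by
  have h1 := sum_sign_prod_antisymm fun x y => a y * (g x y)⁻¹
  have h2 := sum_sign_prod_eq_sum_sign_det fun x y => a y * (g x y)⁻¹
  have h3 := factorial_mul_det_doubleVandermonde a z
  rw [Fintype.card_fin] at h1 h2
  have h4 : ∀ σ : Equiv.Perm (Fin m ⊕ Fin m),
      ∏ i, (a (σ (.inr i)) - a (σ (.inl i))) / g (σ (.inl i)) (σ (.inr i)) =
        ∏ i, (a (σ (.inr i)) * (g (σ (.inl i)) (σ (.inr i)))⁻¹ -
          a (σ (.inl i)) * (g (σ (.inr i)) (σ (.inl i)))⁻¹) := fun σ =>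
    prod_congr rfl fun i _ => by rw [hg (σ (.inr i))]; ring
  simp only [h4]
  rw [h1]
  have hm : (m.factorial : K) ≠ 0 := Nat.cast_ne_zero.2 m.factorial_ne_zero
  have h5 : P * ∑ σ : Equiv.Perm (Fin m ⊕ Fin m), ((Equiv.Perm.sign σ : ℤ) : K) *
      (of fun i j => a (σ (.inr j)) * (g (σ (.inl i)) (σ (.inr j)))⁻¹).det =
      c * (m.factorial * (m.factorial * (doubleVandermonde m a z).det)) := by
    rw [h3, mul_sum, mul_sum]
    refine sum_congr rfl fun σ _ => ?_
    have := det_mul_row (fun j => a (σ (.inr j)))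
      (of fun i j : Fin m => (g (σ (.inl i)) (σ (.inr j)))⁻¹)
    simp only [of_apply] at this
    rw [this]
    linear_combination ((Equiv.Perm.sign σ : ℤ) : K) * (∏ i, a (σ (.inr i))) * h σ
  rw [← h2] at h5
  generalize (∑ σ : Equiv.Perm (Fin m ⊕ Fin m), ((Equiv.Perm.sign σ : ℤ) : K) *
    ∏ i, a (σ (.inr i)) * (g (σ (.inl i)) (σ (.inr i)))⁻¹) = T at h5 ⊢
  field_simp
  -- `h5` carries one more factor m! on both sides, from averaging over one half.
  apply mul_left_cancel₀ hm
  linear_combination h5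

/-! ### Products over pairs and the sign of a splitting. -/

theorem prod_prod_Ioi_comp_perm {K : Type*} [CommMonoid K] {n : ℕ} (σ : Equiv.Perm (Fin n))
    {g : Fin n → Fin n → K} (hg : ∀ i j, g i j = g j i) :
    ∏ i, ∏ j ∈ Ioi i, g (σ i) (σ j) = ∏ i, ∏ j ∈ Ioi i, g i j := by
  rw [prod_sigma', prod_sigma']
  refine prod_nbij' (fun p => ⟨min (σ p.1) (σ p.2), max (σ p.1) (σ p.2)⟩)
    (fun p => ⟨min (σ.symm p.1) (σ.symm p.2), max (σ.symm p.1) (σ.symm p.2)⟩) ?_ ?_ ?_ ?_ ?_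
  · rintro ⟨i, j⟩ h
    have h : i < j := by simpa using h
    simpa using h.ne'
  · rintro ⟨i, j⟩ h
    have h : i < j := by simpa using h
    simpa using h.ne'
  · rintro ⟨i, j⟩ h
    have h : i < j := by simpa using h
    rcases le_total (σ i) (σ j) with h' | h' <;> simp [h', h.le]
  · rintro ⟨i, j⟩ h
    have h : i < j := by simpa using h
    rcases le_total (σ.symm i) (σ.symm j) with h' | h' <;> simp [h', h.le]
  · rintro ⟨i, j⟩ h
    rcases le_total (σ i) (σ j) with h' | h' <;> simp [h', hg (σ i)]

/-- The concatenation of two copies of `Fin m`. -/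
def appendEquiv (m : ℕ) : Fin m ⊕ Fin m ≃ Fin (2 * m) :=
  finSumFinEquiv.trans (finCongr (two_mul m).symm)

theorem prod_prod_Ioi_append {K : Type*} [CommMonoid K] {m : ℕ}
    (g : Fin (2 * m) → Fin (2 * m) → K) :
    ∏ i, ∏ j ∈ Ioi i, g i j =
      (∏ i, ∏ j ∈ Ioi i, g (appendEquiv m (.inl i)) (appendEquiv m (.inl j))) *
      (∏ i, ∏ j ∈ Ioi i, g (appendEquiv m (.inr i)) (appendEquiv m (.inr j))) *
      ∏ i, ∏ j, g (appendEquiv m (.inl i)) (appendEquiv m (.inr j)) := by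
  have h : ∀ (n : ℕ) (f : Fin n → Fin n → K), ∏ i, ∏ j ∈ Ioi i, f i j =
      ∏ i, ∏ j, if i < j then f i j else 1 := fun n f => by
    refine prod_congr rfl fun i _ => ?_
    rw [← prod_filter]
    exact prod_congr (by ext; simp) fun _ _ => rfl
  have h1 : ∀ i j : Fin m, appendEquiv m (.inl i) < appendEquiv m (.inl j) ↔ i < j := by
    intro i j; rw [Fin.lt_def]; simp [appendEquiv]
  have h2 : ∀ i j : Fin m, appendEquiv m (.inr i) < appendEquiv m (.inr j) ↔ i < j := by
    intro i j; rw [Fin.lt_def]; simp [appendEquiv]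
  have h3 : ∀ i j : Fin m, appendEquiv m (.inl i) < appendEquiv m (.inr j) := by
    intro i j; rw [Fin.lt_def]; simp [appendEquiv]; omega
  have h4 : ∀ i j : Fin m, ¬ appendEquiv m (.inr i) < appendEquiv m (.inl j) := by
    intro i j; exact (h3 j i).le.not_gt
  simp only [h]
  rw [← Equiv.prod_comp (appendEquiv m)]
  simp only [← Equiv.prod_comp (appendEquiv m) (fun j => ite (_ < j) _ _),
    Fintype.prod_sum_type, h1, h2, h3, h4, if_true, if_false, prod_const_one,
    prod_mul_distrib]
  rw [mul_one, mul_assoc]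
  congr 1
  exact mul_comm _ _

theorem prod_prod_Ioi_eq_of_equiv {K : Type*} [CommMonoid K] {m : ℕ}
    (e : Fin m ⊕ Fin m ≃ Fin (2 * m))
    {g : Fin (2 * m) → Fin (2 * m) → K} (hg : ∀ i j, g i j = g j i) :
    ∏ i, ∏ j ∈ Ioi i, g i j =
      (∏ i, ∏ j ∈ Ioi i, g (e (.inl i)) (e (.inl j))) *
      (∏ i, ∏ j ∈ Ioi i, g (e (.inr i)) (e (.inr j))) *
      ∏ i, ∏ j, g (e (.inl i)) (e (.inr j)) := by
  rw [← prod_prod_Ioi_comp_perm ((appendEquiv m).symm.trans e) hg, prod_prod_Ioi_append]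
  simp

/-- The equivalence listing `S` and then its complement. -/
def splitEquiv {m : ℕ} (S : Finset (Fin (2 * m))) (hS : S.card = m) :
    Fin m ⊕ Fin m ≃ Fin (2 * m) :=
  finSumEquivOfFinset hS (card_compl_half hS)

/-- Both halves are listed increasingly, so every inversion pairs an element of S with a smaller
element outside S. -/
theorem sign_splitEquiv {m : ℕ} (S : Finset (Fin (2 * m))) (hS : S.card = m) :
    Equiv.Perm.sign ((appendEquiv m).symm.trans (splitEquiv S hS)) =
      (-1) ^ (∑ i : Fin m, (i : ℕ) + ∑ s ∈ S, (s : ℕ)) := by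
  set e := splitEquiv S hS with he
  have hl : ∀ i j : Fin m, e (.inl i) < e (.inl j) ↔ i < j := fun i j => by
    simp [he, splitEquiv]
  have hr : ∀ i j : Fin m, e (.inr i) < e (.inr j) ↔ i < j := fun i j => by
    simp [he, splitEquiv]
  rw [Equiv.Perm.sign_eq_prod_prod_Ioi, prod_prod_Ioi_append]
  simp only [Equiv.trans_apply, Equiv.symm_apply_apply, hl, hr]
  rw [prod_congr rfl fun i _ => prod_congr rfl fun j hj => if_pos (mem_Ioi.1 hj)]
  -- Of the `e (.inl i)` indices below `e (.inl i)`, exactly i lie in S; the others are its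
  -- inversions.
  have hcount : ∀ i : Fin m, (univ.filter fun j => ¬ e (.inl i) < e (.inr j)).card + (i : ℕ) =
      (e (.inl i) : ℕ) := fun i => by
    have h1 : (univ.filter fun x => e x < e (.inl i)).card = (e (.inl i) : ℕ) := by
      rw [← Fin.card_Iio, ← card_map e.toEmbedding]
      congr 1
      ext x
      simp only [mem_map_equiv, mem_filter, mem_univ, true_and, mem_Iio, Equiv.apply_symm_apply]
    rw [← h1, card_filter, card_filter, Fintype.sum_sum_type, ← card_filter, ← card_filter,
      ← card_filter]
    simp only [hl]
    rw [add_comm]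
    congr 1
    · rw [← Fin.card_Iio]; congr 1; ext; simp
    · congr 1; ext j
      simp [not_lt, le_iff_lt_or_eq]
  have hsum : ∑ s ∈ S, (s : ℕ) = ∑ i : Fin m, (e (.inl i) : ℕ) := by
    rw [← map_orderEmbOfFin_univ S hS, sum_map]
    rfl
  rw [hsum, ← sum_congr rfl fun i _ => hcount i, sum_add_distrib]
  simp only [prod_const_one, one_mul, prod_ite, prod_const, prod_pow_eq_pow_sum]
  rw [show ∀ a b : ℕ, a + (b + a) = b + 2 * a by intros; ring, pow_add, pow_mul]
  simp

/-! ### Cauchy determinants for x + y and 1 - xy. -/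

theorem prod_Ioi_mul {K : Type*} [CommMonoid K] {m : ℕ} (x : Fin m → K) :
    ∏ i, ∏ j ∈ Ioi i, x i * x j = ∏ i, x i ^ (m - 1) := by
  refine (prod_prod_Ioi_mul_eq_prod_prod_off_diag fun _ j => x j).trans ?_
  simp [card_compl]

theorem det_vandermonde_neg {K : Type*} [CommRing K] {m : ℕ} (x : Fin m → K) :
    (vandermonde fun i => -x i).det = (-1) ^ (∑ i : Fin m, (i : ℕ)) * (vandermonde x).det := by
  rw [← prod_Ioi_neg_one, det_vandermonde, det_vandermonde, ← prod_mul_distrib]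
  refine prod_congr rfl fun i _ => ?_
  rw [← prod_mul_distrib]
  exact prod_congr rfl fun j _ => by ring

theorem det_vandermonde_inv {K : Type*} [Field K] {m : ℕ} {x : Fin m → K} (hx : ∀ i, x i ≠ 0) :
    (∏ i, (-x i) ^ (m - 1)) * (vandermonde fun i => (x i)⁻¹).det =
      (-1) ^ (∑ i : Fin m, (i : ℕ)) * (vandermonde x).det := by
  rw [← prod_Ioi_neg_one, ← prod_Ioi_mul, det_vandermonde, det_vandermonde, ← prod_mul_distrib,
    ← prod_mul_distrib]
  refine prod_congr rfl fun i _ => ?_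
  rw [← prod_mul_distrib, ← prod_mul_distrib]
  refine prod_congr rfl fun j _ => ?_
  have := hx i
  have := hx j
  field_simp
  ring

theorem neg_one_pow_mul_self (K : Type*) [CommRing K] (n : ℕ) :
    (-1 : K) ^ n * (-1) ^ n = 1 := by
  rw [← mul_pow]; simp

/-- The Cauchy determinant for `1 / (x + y)`. -/
theorem det_cauchy_add {K : Type*} [Field K] {m : ℕ} {x y : Fin m → K}
    (hx : Function.Injective x) (h : ∀ i j, x i + y j ≠ 0) :
    (∏ i, ∏ j, (x i + y j)) * (of fun i j => (x i + y j)⁻¹).det =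
      (vandermonde x).det * (vandermonde y).det := by
  have := det_cauchy_sub (x := fun i => -x i) (y := y) (fun i j h => hx (neg_injective h))
    fun i j h' => h i j (by rw [h']; ring)
  rw [det_vandermonde_neg, ← mul_assoc, neg_one_pow_mul_self, one_mul] at this
  simpa only [sub_neg_eq_add, add_comm (y _)] using this

/-- The Cauchy determinant for `1 / (1 - x y)`. -/
theorem det_cauchy_one_sub_mul {K : Type*} [Field K] {m : ℕ} {x y : Fin m → K}
    (hx : Function.Injective x) (hx0 : ∀ i, x i ≠ 0) (h : ∀ i j, 1 - x i * y j ≠ 0) :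
    (∏ i, ∏ j, (1 - x i * y j)) * (of fun i j => (1 - x i * y j)⁻¹).det =
      (vandermonde x).det * (vandermonde y).det := by
  have h1 := det_cauchy_sub (x := fun i => (x i)⁻¹) (y := y)
    (fun i j h => hx (inv_injective h))
    fun i j h' => h i j (by rw [h', mul_inv_cancel₀ (hx0 i), sub_self])
  -- This passes to the nodes 1/x_i; `det_vandermonde_inv` absorbs the surplus powers of -x_i.
  have h2 : ∀ i j, 1 - x i * y j = -x i * (y j - (x i)⁻¹) := fun i j => by
    have := hx0 i
    field_simp
    ring
  have h3 := det_mul_column (fun i => (-x i)⁻¹) (of fun i j => (y j - (x i)⁻¹)⁻¹)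
  simp only [of_apply] at h3
  simp only [h2, mul_inv, prod_mul_distrib, prod_const, card_univ, Fintype.card_fin] at h3 ⊢
  rw [h3]
  have h4 : (∏ i, (-x i) ^ m) * ∏ i, (-x i)⁻¹ = ∏ i, (-x i) ^ (m - 1) := by
    rw [← prod_mul_distrib]
    refine prod_congr rfl fun i _ => ?_
    rw [pow_sub₀ _ (neg_ne_zero.2 (hx0 i)) (by have := i.2; omega), pow_one]
  have h5 := det_vandermonde_inv hx0
  rw [← h4] at h5
  have h6 := neg_one_pow_mul_self K (∑ i : Fin m, (i : ℕ))
  linear_combination (∏ i, (-x i) ^ m) * (∏ i, (-x i)⁻¹) * h1 +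
    (-1) ^ (∑ i : Fin m, (i : ℕ)) * (vandermonde y).det * h5 +
    (vandermonde x).det * (vandermonde y).det * h6

/-! ### Comparing the Pfaffian and D_S with the double Vandermonde. -/

/-- The even elements of `Fin (2 * m)`. -/
def evens (m : ℕ) : Finset (Fin (2 * m)) :=
  univ.image fun i : Fin m => ⟨2 * i.val, by omega⟩

theorem injective_two_mul (m : ℕ) :
    Function.Injective fun i : Fin m => (⟨2 * i.val, by omega⟩ : Fin (2 * m)) :=
  fun i j h => by simpa [Fin.ext_iff] using h

theorem card_evens (m : ℕ) : (evens m).card = m := by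
  rw [evens, card_image_of_injective _ (injective_two_mul m), card_univ, Fintype.card_fin]

theorem splitEquiv_evens_inl {m : ℕ} (i : Fin m) :
    splitEquiv (evens m) (card_evens m) (.inl i) = ⟨2 * i.val, by omega⟩ := by
  have := orderEmbOfFin_unique (card_evens m)
    (f := fun i : Fin m => (⟨2 * i.val, by omega⟩ : Fin (2 * m)))
    (fun i => by simp [evens]) (fun i j h => by rw [Fin.lt_def] at h ⊢; simpa using h)
  exact (congrFun this i).symm

theorem splitEquiv_evens_inr {m : ℕ} (i : Fin m) :
    splitEquiv (evens m) (card_evens m) (.inr i) = ⟨2 * i.val + 1, by omega⟩ := by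
  have := orderEmbOfFin_unique (card_compl_half (card_evens m))
    (f := fun i : Fin m => (⟨2 * i.val + 1, by omega⟩ : Fin (2 * m)))
    (fun i => by simp [evens, Fin.ext_iff]; omega) (fun i j h => by rw [Fin.lt_def] at h ⊢; simpa using h)
  exact (congrFun this i).symm

/-- The Pfaffian pairs 2i with 2i + 1, so the even/odd splitting is the reference order in which no
sign appears. -/
theorem pfaffian_eq_sum_perm_sum {K : Type*} [Field K] {m : ℕ}
    (A : Matrix (Fin (2 * m)) (Fin (2 * m)) K) :
    pfaffian A = 1 / (2 ^ m * (m.factorial : K)) *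
      ∑ σ : Equiv.Perm (Fin m ⊕ Fin m), ((Equiv.Perm.sign σ : ℤ) : K) *
        ∏ i, A (splitEquiv (evens m) (card_evens m) (σ (.inl i)))
          (splitEquiv (evens m) (card_evens m) (σ (.inr i))) := by
  rw [pfaffian, ← Equiv.sum_comp (splitEquiv (evens m) (card_evens m)).permCongr]
  congr 1
  refine sum_congr rfl fun σ _ => ?_
  rw [Equiv.Perm.sign_permCongr]
  simp only [← splitEquiv_evens_inl, ← splitEquiv_evens_inr, Equiv.permCongr_apply,
    Equiv.symm_apply_apply]

theorem sum_evens (m : ℕ) : ∑ s ∈ evens m, (s : ℕ) = 2 * ∑ i : Fin m, (i : ℕ) := by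
  rw [evens, sum_image (injective_two_mul m).injOn, mul_sum]

/-- The rows are permuted by the quotient of two splittings. The even one contributes an even sum of
elements, and the common sums over `Fin m` cancel mod 2. -/
theorem det_doubleVandermonde_splitEquiv {K : Type*} [CommRing K] {m : ℕ}
    (a z : Fin (2 * m) → K) (S : Finset (Fin (2 * m))) (hS : S.card = m) :
    (doubleVandermonde m (a ∘ splitEquiv S hS) (z ∘ splitEquiv S hS)).det =
      (-1) ^ (∑ s ∈ S, (s : ℕ)) *
        (doubleVandermonde m (a ∘ splitEquiv (evens m) (card_evens m))
          (z ∘ splitEquiv (evens m) (card_evens m))).det := by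
  set e := splitEquiv (evens m) (card_evens m) with he
  have h := det_permute ((splitEquiv S hS).trans e.symm) (doubleVandermonde m (a ∘ e) (z ∘ e))
  have h1 : (doubleVandermonde m (a ∘ e) (z ∘ e)).submatrix ((splitEquiv S hS).trans e.symm) id =
      doubleVandermonde m (a ∘ splitEquiv S hS) (z ∘ splitEquiv S hS) := by
    ext k (i | i) <;> simp [doubleVandermonde]
  have h2 : Equiv.Perm.sign ((splitEquiv S hS).trans e.symm) = (-1) ^ (∑ s ∈ S, (s : ℕ)) := by
    have h3 : ((appendEquiv m).symm.trans ((splitEquiv S hS).trans e.symm)).trans (appendEquiv m) =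
        ((appendEquiv m).symm.trans e)⁻¹ * (appendEquiv m).symm.trans (splitEquiv S hS) := by
      ext x; simp [Equiv.Perm.inv_def]
    rw [← Equiv.Perm.sign_symm_trans_trans _ (appendEquiv m), Equiv.trans_assoc]
    rw [Equiv.trans_assoc] at h3
    rw [h3,
      Equiv.Perm.sign_mul, Equiv.Perm.sign_inv, sign_splitEquiv, sign_splitEquiv, sum_evens,
      ← pow_add]
    rw [show ∀ a b : ℕ, a + 2 * a + (a + b) = 2 * (2 * a) + b by intros; ring, pow_add, pow_mul]
    simp
  rw [← h1, h, h2]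
  simp

theorem two_mul_sum_fin (m : ℕ) : 2 * ∑ i : Fin m, (i : ℕ) + m = m * m := by
  rw [Fin.sum_univ_eq_sum_range (fun i => i) m]
  have := Finset.sum_range_id_mul_two m
  rcases m with _ | m
  · simp
  · simp only [Nat.add_sub_cancel] at this
    linarith

theorem signedDet_eq_det_doubleVandermonde {K : Type*} [Field K] {m : ℕ} (a z : Fin (2 * m) → K)
    (hz : Function.Injective z) (S : Finset (Fin (2 * m))) (hS : S.card = m) :
    signedDet a z S hS = (doubleVandermonde m (a ∘ splitEquiv (evens m) (card_evens m))
      (z ∘ splitEquiv (evens m) (card_evens m))).det := by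
  have h1 := det_doubleVandermonde (a := a ∘ splitEquiv S hS) (hz.comp (splitEquiv S hS).injective)
  rw [det_doubleVandermonde_splitEquiv] at h1
  have hprod : ∏ i ∈ S, ∏ j ∈ Sᶜ, (z j - z i) =
      ∏ i, ∏ j, ((z ∘ splitEquiv S hS) (.inr j) - (z ∘ splitEquiv S hS) (.inl i)) := by
    have hT : ∀ (T : Finset (Fin (2 * m))) (hT : T.card = m) (f : Fin (2 * m) → K),
        ∏ i ∈ T, f i = ∏ i, f (T.orderEmbOfFin hT i) := fun T hT f => by
      conv_lhs => rw [← map_orderEmbOfFin_univ T hT, prod_map]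
      rfl
    rw [hT S hS]
    exact prod_congr rfl fun i _ => hT _ (card_compl_half hS) _
  have hsplit : splitSubmatrix (of fun i j => (a j - a i) / (z j - z i)) S hS =
      of fun i j : Fin m => ((a ∘ splitEquiv S hS) (.inr j) - (a ∘ splitEquiv S hS) (.inl i)) /
        ((z ∘ splitEquiv S hS) (.inr j) - (z ∘ splitEquiv S hS) (.inl i)) := rfl
  rw [signedDet, hprod, hsplit]
  have hexp : (-1 : K) ^ (m * (m + 1) / 2 + ∑ s ∈ S, (s.val + 1)) =
      (-1) ^ (∑ s ∈ S, (s : ℕ)) * (-1) ^ (∑ i : Fin m, (i : ℕ)) := by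
    have hm := two_mul_sum_fin m
    have : m * (m + 1) / 2 = ∑ i : Fin m, (i : ℕ) + m := by
      rw [mul_add, ← hm]; omega
    rw [this, sum_add_distrib, sum_const, hS, smul_eq_mul, mul_one,
      show ∀ a b c : ℕ, a + b + (c + b) = c + a + 2 * b by intros; ring, pow_add, pow_mul,
      pow_add]
    simp
  rw [hexp]
  have hs := neg_one_pow_mul_self K (∑ s ∈ S, (s : ℕ))
  linear_combination (-(-1) ^ (∑ s ∈ S, (s : ℕ))) * h1 +
    (doubleVandermonde m (a ∘ splitEquiv (evens m) (card_evens m))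
      (z ∘ splitEquiv (evens m) (card_evens m))).det * hs

/-! ### The two Pfaffian formulas. -/

theorem prod_mul_pfaffian_eq_signedDet {K : Type*} [Field K] [CharZero K] {m : ℕ}
    (a z : Fin (2 * m) → K) (hz : Function.Injective z) (S : Finset (Fin (2 * m)))
    (hS : S.card = m) (g : Fin (2 * m) → Fin (2 * m) → K) (hg : ∀ i j, g i j = g j i) (c : K)
    (h : ∀ e : Fin m ⊕ Fin m ≃ Fin (2 * m),
      (∏ i, ∏ j ∈ Ioi i, g (e (.inl i)) (e (.inl j))) *
      (∏ i, ∏ j ∈ Ioi i, g (e (.inr i)) (e (.inr j))) *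
      ((∏ i, ∏ j, g (e (.inl i)) (e (.inr j))) *
        (of fun i j : Fin m => (g (e (.inl i)) (e (.inr j)))⁻¹).det) =
      c * ((vandermonde fun i => z (e (.inl i))).det * (vandermonde fun i => z (e (.inr i))).det)) :
    (∏ i, ∏ j ∈ Ioi i, g i j) * pfaffian (of fun i j => (a j - a i) / g i j) =
      c * signedDet a z S hS := by
  rw [signedDet_eq_det_doubleVandermonde a z hz, pfaffian_eq_sum_perm_sum]
  set e := splitEquiv (evens m) (card_evens m)
  refine sum_sign_prod_div_eq_det_doubleVandermonde (a ∘ e) (z ∘ e) (fun x y => g (e x) (e y))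
    (fun x y => hg _ _) _ c fun σ => ?_
  rw [prod_prod_Ioi_eq_of_equiv (σ.trans e) hg, mul_assoc]
  exact h (σ.trans e)

theorem signedDet_eq_pfaffian_sqrt {K : Type*} [Field K] [CharZero K] {m : ℕ}
    (a z : Fin (2 * m) → K) (hz : Function.Injective z) (S : Finset (Fin (2 * m)))
    (hS : S.card = m) (r : Fin (2 * m) → K) (hr : ∀ i, r i ^ 2 = z i) :
    signedDet a z S hS = (∏ i, ∏ j ∈ Ioi i, (r i + r j)) *
      pfaffian (of fun i j => (a j - a i) / (r j + r i)) := by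
  have hinj : Function.Injective r := fun i j h => hz (by rw [← hr, ← hr, h])
  -- Since z_j - z_i = (r_j + r_i)(r_j - r_i), the factors within one half turn the Vandermonde in r
  -- into that in z.
  have hV : ∀ f : Fin m → Fin (2 * m), (∏ i, ∏ j ∈ Ioi i, (r (f j) + r (f i))) *
      (vandermonde fun i => r (f i)).det = (vandermonde fun i => z (f i)).det := fun f => by
    rw [det_vandermonde, det_vandermonde, ← prod_mul_distrib]
    refine prod_congr rfl fun i _ => ?_
    rw [← prod_mul_distrib]
    exact prod_congr rfl fun j _ => by rw [← hr, ← hr]; ring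
  have := prod_mul_pfaffian_eq_signedDet a z hz S hS (fun i j => r j + r i)
    (fun i j => add_comm _ _) 1 fun e => by
      have hc := det_cauchy_add (x := fun i => r (e (.inl i))) (y := fun i => r (e (.inr i)))
        (fun i j h => by simpa using hinj h) fun i j h => by
          have h' : z (e (.inl i)) = z (e (.inr j)) := by
            rw [← hr, ← hr, eq_neg_of_add_eq_zero_left h, neg_sq]
          simpa using hz h'
      simp only [add_comm (r (e (.inr _))) (r (e (.inl _)))]
      rw [hc, ← hV, ← hV]
      ring
  rw [one_mul] at this
  rw [← this]
  simp only [add_comm]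

theorem signedDet_eq_pfaffian_one_sub {K : Type*} [Field K] [CharZero K] {m : ℕ}
    (a z : Fin (2 * m) → K) (hz : Function.Injective z) (S : Finset (Fin (2 * m)))
    (hS : S.card = m) (ζ : Fin (2 * m) → K) (hζ0 : ∀ i, ζ i ≠ 0)
    (hζ : ∀ i, ζ i + (ζ i)⁻¹ = z i + 2) :
    signedDet a z S hS = (∏ i, ζ i ^ (1 - (m : ℤ))) * (∏ i, ∏ j ∈ Ioi i, (1 - ζ i * ζ j)) *
      pfaffian (of fun i j => (a j - a i) / (1 - ζ i * ζ j)) := by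
  have hinj : Function.Injective ζ := fun i j h => hz (by
    have h1 := hζ i
    rw [h, hζ j] at h1
    exact (add_right_cancel h1).symm)
  -- Here (1 - ζ_i ζ_j)(ζ_j - ζ_i) = -ζ_i ζ_j (z_j - z_i), and each ζ_i lies in m - 1 pairs of its
  -- half.
  have hV : ∀ f : Fin m → Fin (2 * m), (∏ i, ∏ j ∈ Ioi i, (1 - ζ (f i) * ζ (f j))) *
      (vandermonde fun i => ζ (f i)).det = (-1) ^ (∑ i : Fin m, (i : ℕ)) *
        (∏ i, ζ (f i) ^ (m - 1)) * (vandermonde fun i => z (f i)).det := fun f => by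
    rw [← prod_Ioi_neg_one, ← prod_Ioi_mul, det_vandermonde, det_vandermonde, ← prod_mul_distrib,
      ← prod_mul_distrib, ← prod_mul_distrib]
    refine prod_congr rfl fun i _ => ?_
    rw [← prod_mul_distrib, ← prod_mul_distrib, ← prod_mul_distrib]
    refine prod_congr rfl fun j _ => ?_
    rw [eq_sub_of_add_eq (hζ (f i)).symm, eq_sub_of_add_eq (hζ (f j)).symm]
    have := hζ0 (f i)
    have := hζ0 (f j)
    field_simp
    ring
  have := prod_mul_pfaffian_eq_signedDet a z hz S hS (fun i j => 1 - ζ i * ζ j)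
    (fun i j => by rw [mul_comm]) (∏ i, ζ i ^ (m - 1)) fun e => by
      rw [det_cauchy_one_sub_mul (x := fun i => ζ (e (.inl i))) (y := fun i => ζ (e (.inr i)))
        (fun i j h => by simpa using hinj h) (fun i => hζ0 _) fun i j h => by
          have h1 : ζ (e (.inr j)) = (ζ (e (.inl i)))⁻¹ :=
            (inv_eq_of_mul_eq_one_right (sub_eq_zero.1 h).symm).symm
          have h2 := hζ (e (.inr j))
          rw [h1, inv_inv, add_comm, hζ] at h2
          simpa using hz (add_right_cancel h2)]
      have h1 := hV fun i => e (.inl i)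
      have h2 := hV fun i => e (.inr i)
      rw [← Equiv.prod_comp e, Fintype.prod_sum_type]
      have hs := neg_one_pow_mul_self K (∑ i : Fin m, (i : ℕ))
      rw [mul_mul_mul_comm, h1, h2]
      linear_combination (∏ i, ζ (e (.inl i)) ^ (m - 1)) * (∏ i, ζ (e (.inr i)) ^ (m - 1)) *
        (vandermonde fun i => z (e (.inl i))).det * (vandermonde fun i => z (e (.inr i))).det * hs
  rw [mul_assoc, this, ← mul_assoc, ← prod_mul_distrib, prod_eq_one, one_mul]
  intro i _
  -- An index exists, so the natural subtraction m - 1 is not truncated and cancels the integer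
  -- exponent 1 - m.
  have hm : 1 ≤ m := by have := i.2; omega
  rw [← zpow_natCast, ← zpow_add₀ (hζ0 i), Nat.cast_sub hm]
  simp

theorem mainTheorem6 {K : Type*} [Field K] [CharZero K] (m : ℕ)
    (a z : Fin (2 * m) → K) (hz : Function.Injective z)
    (S : Finset (Fin (2 * m))) (hS : S.card = m) :
    (∀ r : Fin (2 * m) → K, (∀ i, r i ^ 2 = z i) →
      signedDet a z S hS =
        (∏ i, ∏ j ∈ Finset.Ioi i, (r i + r j)) *
          pfaffian (Matrix.of fun i j => (a j - a i) / (r j + r i))) ∧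
    (∀ ζ : Fin (2 * m) → K, (∀ i, ζ i ≠ 0) → (∀ i, ζ i + (ζ i)⁻¹ = z i + 2) →
      signedDet a z S hS =
        (∏ i, ζ i ^ (1 - (m : ℤ))) * (∏ i, ∏ j ∈ Finset.Ioi i, (1 - ζ i * ζ j)) *
          pfaffian (Matrix.of fun i j => (a j - a i) / (1 - ζ i * ζ j))) := by
  exact ⟨signedDet_eq_pfaffian_sqrt a z hz S hS, signedDet_eq_pfaffian_one_sub a z hz S hS⟩
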